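/- Let $E$ be a field of characteristic different from $2$ that is finitely generated (as a field) of transcendence degree at least $1$ over some subfield. Fix an algebraic closure $\Omega$ of $E$. Let $E_{\mathrm{pyth}}\subseteq\Omega$ (the pythagorean closure of $E$) be the union of all fields obtained from $E$ by finitely many steps, each adjoining a square root in $\Omega$ of a sum of two squares of the preceding field, and let $E_{\mathrm{quad}}\subseteq\Omega$ (the quadratic closure of $E$) be the union of all fields obtained from $E$ by finitely many steps, each adjoining a square root in $\Omega$ of an arbitrary element of the preceding field. Then $E_{\mathrm{pyth}}$ and $E_{\mathrm{quad}}$ are both hereditarily non-pythagorean. Here a field is called pythagorean if each of its sums of squares is a square, and a field $K$ is called hereditarily non-pythagorean if every proper finite extension $F/K$ that is not purely inseparable is non-pythagorean. -/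

import Mathlib

universe u v

open scoped IntermediateField

/-- A field is pythagorean if every sum of squares is a square. -/
def IsPythagorean (K : Type u) [Field K] : Prop :=
  ∀ x : K, IsSumSq x → IsSquare x

/-- `k` is hereditarily non-pythagorean if every proper finite field extension `F / k` that is
not purely inseparable is non-pythagorean. (A finite extension of `k` always has an isomorphic
copy in the universe of `k`.) -/
def IsHereditarilyNonPythagorean (k : Type u) [Field k] : Prop :=
  ∀ (F : Type u) [Field F] [Algebra k F] [FiniteDimensional k F],
    1 < Module.finrank k F → ¬ IsPurelyInseparable k F → ¬ IsPythagorean F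

section Closures

variable (E : Type u) [Field E] (Ω : Type v) [Field Ω] [Algebra E Ω]

/-- `L` is reached from `E` by a finite chain of steps inside `Ω`, each adjoining to the
predecessor a square root of a sum of two squares of the predecessor. (A step whose square root is
already in the predecessor changes nothing; all other steps are quadratic extensions when the
characteristic is not two.) -/
inductive IsPythagoreanTower : IntermediateField E Ω → Prop
  | base : IsPythagoreanTower ⊥
  | step (K : IntermediateField E Ω) (a b c : Ω) (hK : IsPythagoreanTower K)
      (ha : a ∈ K) (hb : b ∈ K) (hc : c ^ 2 = a ^ 2 + b ^ 2) : IsPythagoreanTower (K ⊔ E⟮c⟯)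

/-- `L` is reached from `E` by a finite chain of steps inside `Ω`, each adjoining to the
predecessor a square root of an arbitrary element of the predecessor. -/
inductive IsQuadraticTower : IntermediateField E Ω → Prop
  | base : IsQuadraticTower ⊥
  | step (K : IntermediateField E Ω) (a c : Ω) (hK : IsQuadraticTower K)
      (ha : a ∈ K) (hc : c ^ 2 = a) : IsQuadraticTower (K ⊔ E⟮c⟯)

/-- The pythagorean closure of `E` inside `Ω` (an algebraic closure of `E`): the directed union of
all the towers above, taken as a supremum of intermediate fields. -/
def pythagoreanClosure : IntermediateField E Ω :=
  sSup {L | IsPythagoreanTower E Ω L}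

/-- The quadratic closure of `E` inside `Ω` (an algebraic closure of `E`). -/
def quadraticClosure : IntermediateField E Ω :=
  sSup {L | IsQuadraticTower E Ω L}

end Closures

open Polynomial

/-! Both closures are Galois over `E`, and `E` is finite over some k(X). Every Galois extension K of
such an `E` is hereditarily non-pythagorean, for the following reason. Let θ generate the separable
part of F/K, with minimal polynomial p and distinct roots θ₁, θ₂. For x, a in k(X) put f(T) = (x -
T^n)² + a². If F were pythagorean, then f(θ) = G(θ)² with deg G < deg p. Automorphisms of K fixing p
and f send G to ±G, so products of two coefficients of G descend
(`coeff_mul_coeff_mem_range_of_dvd_sq_sub`). Hence f(θ₁)f(θ₂) is a square in a field N, finite over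
k(X) and independent of x, a and n. This contradicts `exists_not_isSquare_mul_add_sq`: with i² = -1
the product splits into four factors linear in x, and, after reduction to separable N and integral
θ's, x and a are chosen so that some prime divides one factor exactly once and the others not at
all. -/

/-! ### Primes dividing x - α exactly once in finite extensions of k[X]. -/

theorem exists_natDegree_lt_eval_mul_of_monic {k : Type*} [Field k] {Q : k[X][X]}
    (hQ : Q.Monic) (hn : 0 < Q.natDegree) {r : k[X]} (hr : r ≠ 0) (C : ℕ) :
    ∃ y : k[X], C < (Q.eval (r * y)).natDegree := by
  set n := Q.natDegree with hn'
  -- Large enough for the leading term to dominate all others and to have degree above `C`.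
  set D := C + ∑ i ∈ Finset.range n, (Q.coeff i).natDegree + 1 with hD
  refine ⟨X ^ D, ?_⟩
  set x := r * X ^ D with hx
  have hxD : D ≤ x.natDegree := by
    rw [hx, natDegree_mul hr (pow_ne_zero _ X_ne_zero), natDegree_X_pow]
    omega
  have hlt : (∑ i ∈ Finset.range n, Q.coeff i * x ^ i).natDegree < (x ^ n).natDegree := by
    rw [natDegree_pow]
    refine lt_of_le_of_lt (natDegree_sum_le_of_forall_le (n := n * x.natDegree - 1) _ _ ?_) ?_
    · intro i hi
      have hin := Finset.mem_range.mp hi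
      have h1 : (Q.coeff i).natDegree ≤ ∑ i ∈ Finset.range n, (Q.coeff i).natDegree :=
        Finset.single_le_sum (f := fun i => (Q.coeff i).natDegree) (fun _ _ => Nat.zero_le _) hi
      refine natDegree_mul_le.trans ?_
      rw [natDegree_pow]
      have h2 : (i + 1) * x.natDegree ≤ n * x.natDegree := Nat.mul_le_mul_right _ hin
      rw [add_mul] at h2
      omega
    · have : 0 < n * x.natDegree := Nat.mul_pos hn (by omega)
      omega
  have heval : Q.eval x = x ^ n + ∑ i ∈ Finset.range n, Q.coeff i * x ^ i := by
    conv_lhs => rw [hQ.as_sum]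
    simp [eval_finsetSum, hn']
  rw [heval, natDegree_add_eq_left_of_natDegree_lt hlt, natDegree_pow]
  have : 1 * x.natDegree ≤ n * x.natDegree := Nat.mul_le_mul_right _ hn
  omega

section

variable {k : Type*} [Field k] {B : Type*} [CommRing B] [Algebra k[X] B]
  [Module.Finite k[X] B] [Module.IsTorsionFree k[X] B]

/-- For x a multiple of αδ, x - α = αu with u ≡ -1 mod δ, so a prime containing u avoids δ. The norm
of x - α is the characteristic polynomial of α at x; its degree is unbounded, so u can be made a
non-unit. -/
theorem exists_isMaximal_algebraMap_sub_mem [IsDomain B] {α δ : B} (hα : α ≠ 0) (hδ : δ ≠ 0) :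
    ∃ (x : k[X]) (w : Ideal B), w.IsMaximal ∧ w ≠ ⊥ ∧ algebraMap k[X] B x - α ∈ w ∧ δ ∉ w := by
  have hinj := FaithfulSMul.algebraMap_injective k[X] B
  have : Module.Free k[X] B := inferInstance
  obtain ⟨r, hr0, z, hz⟩ := (Algebra.IsIntegral.isIntegral (R := k[X]) (α * δ)).isAlgebraic
    |>.exists_nonzero_dvd (mem_nonZeroDivisors_of_ne_zero (mul_ne_zero hα hδ))
  set Q := (LinearMap.mulLeft k[X] α).charpoly with hQ
  have hQd : 0 < Q.natDegree := by
    rw [hQ, LinearMap.charpoly_natDegree]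
    exact Module.finrank_pos
  obtain ⟨y, hy⟩ := exists_natDegree_lt_eval_mul_of_monic (LinearMap.charpoly_monic _) hQd hr0
    (Algebra.norm k[X] α).natDegree
  set u := δ * z * algebraMap k[X] B y - 1 with hu
  have hru : algebraMap k[X] B (r * y) - α = α * u := by
    rw [map_mul, hz, hu]; ring
  have hnu : ¬ IsUnit u := by
    intro h
    have h1 := (h.map (Algebra.norm k[X]))
    have h2 : Q.eval (r * y) = Algebra.norm k[X] α * Algebra.norm k[X] u := by
      rw [← map_mul, ← hru, hQ, LinearMap.eval_charpoly, Algebra.norm_apply]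
      congr 1
      ext b
      simp [Algebra.smul_def, mul_assoc]
    rw [h2] at hy
    have h3 := natDegree_eq_zero_of_isUnit h1
    have := natDegree_mul_le (p := Algebra.norm k[X] α) (q := Algebra.norm k[X] u)
    omega
  obtain ⟨w, hw, huw⟩ := exists_max_ideal_of_mem_nonunits hnu
  refine ⟨r * y, w, hw, ?_, ?_, ?_⟩
  · refine Ring.ne_bot_of_isMaximal_of_not_isField hw fun h => Polynomial.not_isField k ?_
    exact (Algebra.IsIntegral.isField_iff_isField hinj).mpr h
  · rw [hru]; exact w.mul_mem_left _ huw
  · intro hd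
    refine hw.ne_top ((Ideal.eq_top_iff_one _).mpr ?_)
    have : (1 : B) = δ * z * algebraMap k[X] B y - u := by rw [hu]; ring
    rw [this]
    exact w.sub_mem (w.mul_mem_right _ (w.mul_mem_right _ hd)) huw

variable {L N : Type*} [Field L] [Algebra k[X] L] [IsFractionRing k[X] L] [Field N]
  [Algebra B N] [IsFractionRing B N] [Algebra k[X] N] [IsScalarTower k[X] B N] [Algebra L N]
  [IsScalarTower k[X] L N]

/-- Putting a nonzero element of the different into δ forces w to be unramified over k[X]. A
generator π of the prime below then lies in w but not in w², and replacing x by x + π repairs a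
multiplicity that is too high. -/
theorem exists_isMaximal_algebraMap_sub_notMem_sq [IsDedekindDomain B]
    [FiniteDimensional L N] [Algebra.IsSeparable L N] {α δ : B} (hα : α ≠ 0) (hδ : δ ≠ 0) :
    ∃ (x : k[X]) (w : Ideal B), w.IsMaximal ∧ algebraMap k[X] B x - α ∈ w ∧
      algebraMap k[X] B x - α ∉ w ^ 2 ∧ δ ∉ w := by
  obtain ⟨d, hd, hd0⟩ := Submodule.exists_mem_ne_zero_of_ne_bot
    (p := differentIdeal k[X] B) (by
      have : IsIntegralClosure B k[X] N := IsIntegralClosure.of_isIntegrallyClosed _ _ _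
      rw [ne_eq, ← FractionalIdeal.coeIdeal_inj (K := N), coeIdeal_differentIdeal (K := L)]
      simp)
  obtain ⟨x, w, hw, hw0, hxw, hdw⟩ :=
    exists_isMaximal_algebraMap_sub_mem (k := k) hα (mul_ne_zero hd0 hδ)
  have hδw : δ ∉ w := fun h => hdw (w.mul_mem_left _ h)
  have hdw' : d ∉ w := fun h => hdw (w.mul_mem_right _ h)
  obtain ⟨π, hπ⟩ := (IsPrincipalIdealRing.principal (w.under k[X])).principal
  have hπw : algebraMap k[X] B π ∈ w := by
    have : π ∈ w.under k[X] := by rw [hπ]; exact Submodule.mem_span_singleton_self π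
    exact this
  have hπw2 : algebraMap k[X] B π ∉ w ^ 2 := by
    intro h
    have hdvd : w ^ 2 ∣ (w.under k[X]).map (algebraMap k[X] B) := by
      rw [Ideal.dvd_iff_le, hπ, Ideal.submodule_span_eq, Ideal.map_span, Set.image_singleton,
        Ideal.span_singleton_le_iff_mem]
      exact h
    have hmax : (w.under k[X]).IsMaximal := Ideal.isMaximal_comap_of_isIntegral_of_isMaximal w
    have : IsIntegralClosure B k[X] N := IsIntegralClosure.of_isIntegrallyClosed _ _ _
    have := pow_sub_one_dvd_differentIdeal_aux (A := k[X]) L N w two_ne_zero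
      (mt Ideal.eq_bot_of_comap_eq_bot hw0) hdvd
    rw [show 2 - 1 = 1 from rfl, pow_one, Ideal.dvd_iff_le] at this
    exact hdw' (this hd)
  by_cases hx2 : algebraMap k[X] B x - α ∈ w ^ 2
  · have he : algebraMap k[X] B (x + π) - α = (algebraMap k[X] B x - α) + algebraMap k[X] B π := by
      rw [map_add]; ring
    refine ⟨x + π, w, hw, ?_, ?_, hδw⟩
    · rw [he]; exact w.add_mem hxw hπw
    · rw [he]; exact fun h => hπw2 ((Submodule.add_mem_iff_right _ hx2).mp h)
  · exact ⟨x, w, hw, hxw, hx2, hδw⟩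

theorem exists_not_isSquare_mul_add_sq_of_isDedekindDomain [IsDedekindDomain B]
    [FiniteDimensional L N] [Algebra.IsSeparable L N] (h2 : (2 : B) ≠ 0) {i : B}
    (hi : i ^ 2 = -1) {θ θ' : B} (hθ : θ ≠ θ') :
    ∃ x a : k[X], ¬ IsSquare (((algebraMap k[X] B x - θ) ^ 2 + algebraMap k[X] B a ^ 2) *
      ((algebraMap k[X] B x - θ') ^ 2 + algebraMap k[X] B a ^ 2)) := by
  have hinj := FaithfulSMul.algebraMap_injective k[X] B
  have hi0 : i ≠ 0 := by rintro rfl; simp at hi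
  -- With α = θ - ia, the three factors keep a, α and θ - θ' - 2ia nonzero. Up to sign, α differs
  -- from the other three roots by 2ia, θ - θ' and θ - θ' - 2ia, which go into δ below.
  obtain ⟨a, ha⟩ : ∃ a : k[X], ¬ (X * (C θ - C i * X) * (C (θ - θ') - C (2 * i) * X)).IsRoot
      (algebraMap k[X] B a) := by
    by_contra! h
    have hp : X * (C θ - C i * X) * (C (θ - θ') - C (2 * i) * X) ≠ 0 := by
      refine mul_ne_zero (mul_ne_zero X_ne_zero fun h => ?_) fun h => ?_
      · have := congr_arg (coeff · 1) h
        simp [hi0] at this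
      · have := congr_arg (coeff · 1) h
        simp [hi0, h2] at this
    refine Set.infinite_range_of_injective hinj
      ((finite_setOfPred_isRoot hp).subset ?_)
    rintro _ ⟨a, rfl⟩
    exact h a
  simp only [IsRoot.def, eval_mul, eval_X, eval_sub, eval_C, mul_eq_zero, not_or] at ha
  obtain ⟨⟨ha0, ha1⟩, ha2⟩ := ha
  set b := algebraMap k[X] B a with hb
  obtain ⟨x, w, hw, hxw, hxw2, hδ⟩ := exists_isMaximal_algebraMap_sub_notMem_sq (k := k)
    (L := L) (N := N) ha1
    (mul_ne_zero (mul_ne_zero (mul_ne_zero h2 hi0) ha0)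
      (mul_ne_zero (sub_ne_zero.mpr hθ) ha2))
  refine ⟨x, a, ?_⟩
  rw [← hb]
  set y := algebraMap k[X] B x with hy
  have hδ1 : 2 * i * b ∉ w := fun h => hδ (w.mul_mem_right _ h)
  have hδ2 : θ - θ' ∉ w := fun h => hδ (w.mul_mem_left _ (w.mul_mem_right _ h))
  have hδ3 : θ - θ' - 2 * i * b ∉ w := fun h => hδ (w.mul_mem_left _ (w.mul_mem_left _ h))
  have hfac : ∀ t : B, (y - t) ^ 2 + b ^ 2 = (y - (t - i * b)) * (y - (t + i * b)) := by
    intro t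
    linear_combination b ^ 2 * hi
  have hn1 : y - (θ + i * b) ∉ w := fun h => hδ1 (by
    convert w.sub_mem hxw h using 1; ring)
  have hn2 : y - (θ' - i * b) ∉ w := fun h => hδ2 (by
    convert w.sub_mem h hxw using 1; ring)
  have hn3 : y - (θ' + i * b) ∉ w := fun h => hδ3 (by
    convert w.sub_mem h hxw using 1; ring)
  rintro ⟨s, hs⟩
  rw [hfac, hfac, mul_assoc] at hs
  have hprime := hw.isPrime
  have hsw : s ∈ w := (hprime.mul_mem_iff_mem_or_mem.mp (hs ▸ w.mul_mem_right _ hxw)).elim id id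
  have hs2 : s * s ∈ w ^ 2 := by rw [← pow_two]; exact Ideal.pow_mem_pow hsw 2
  rw [← hs, mul_comm] at hs2
  rcases Ideal.IsMaximal.mul_mem_pow w hs2 with h | h
  · rcases hprime.mem_or_mem h with h | h
    · exact hn1 h
    · exact (hprime.mem_or_mem h).elim hn2 hn3
  · exact hxw2 h

end

/-! ### Non-squares in arbitrary finite extensions of k(X). -/

theorem mem_separableClosure_of_sq_mem {F E : Type*} [Field F] [Field E] [Algebra F E]
    (h2 : (2 : E) ≠ 0) {y : E} (hy : y ^ 2 ∈ separableClosure F E) : y ∈ separableClosure F E := by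
  rcases eq_or_ne y 0 with rfl | hy0
  · exact zero_mem _
  rw [mem_separableClosure_iff]
  have h2' : ((2 : ℕ) : separableClosure F E) ≠ 0 := fun h =>
    h2 (congr_arg (algebraMap (separableClosure F E) E) h)
  have hsep : IsSeparable (separableClosure F E) y := by
    refine (separable_X_pow_sub_C (⟨y ^ 2, hy⟩ : separableClosure F E) h2' ?_).of_dvd
      (minpoly.dvd _ _ ?_)
    · exact fun h => hy0 (by simpa using congr_arg Subtype.val h)
    · simp [IntermediateField.algebraMap_apply]
  exact IsSeparable.of_algebra_isSeparable_of_isSeparable F hsep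

section

variable (L : Type*) [Field L] {N : Type*} [Field N] [Algebra L N] [FiniteDimensional L N]

theorem exists_not_isSquare_mul_add_sq_of_isSeparable (k : Type*) [Field k] [Algebra k[X] L]
    [IsFractionRing k[X] L] [Algebra.IsSeparable L N]
    (h2 : (2 : N) ≠ 0) {i : N} (hi : i ^ 2 = -1) {θ θ' : N} (hθ : θ ≠ θ') :
    ∃ x a : L, ¬ IsSquare (((algebraMap L N x - θ) ^ 2 + algebraMap L N a ^ 2) *
      ((algebraMap L N x - θ') ^ 2 + algebraMap L N a ^ 2)) := by
  let : Algebra k[X] N := ((algebraMap L N).comp (algebraMap k[X] L)).toAlgebra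
  have : IsScalarTower k[X] L N := .of_algebraMap_eq' rfl
  have hinj : Function.Injective (algebraMap k[X] N) :=
    (algebraMap L N).injective.comp (IsFractionRing.injective k[X] L)
  let B := integralClosure k[X] N
  have : IsDedekindDomain B := integralClosure.isDedekindDomain k[X] L N
  have : Module.Finite k[X] B := IsIntegralClosure.finite k[X] L N B
  have : IsFractionRing B N := integralClosure.isFractionRing_of_finite_extension L N
  have : Module.IsTorsionFree k[X] N := by
    rw [Module.isTorsionFree_iff_algebraMap_injective]
    exact hinj
  have : Module.IsTorsionFree k[X] B := inferInstance
  have : Algebra.IsAlgebraic k[X] N := by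
    rw [IsFractionRing.comap_isAlgebraic_iff (A := k[X]) (K := L)]
    infer_instance
  classical
  -- Scaling x, a, θ and θ' by a common denominator d multiplies the product by d⁴, a square.
  obtain ⟨d, hd, hdi⟩ := exists_integral_multiples k[X] L (L := N) {θ, θ'}
  have hd0 : algebraMap k[X] N d ≠ 0 := fun h => hd (hinj (by simpa using h))
  have hθd := hdi θ (by simp)
  have hθ'd := hdi θ' (by simp)
  have hii : IsIntegral k[X] i :=
    IsIntegral.of_pow two_pos (by rw [hi]; exact isIntegral_one.neg)
  obtain ⟨x, a, hxa⟩ := exists_not_isSquare_mul_add_sq_of_isDedekindDomain (k := k) (B := B)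
    (L := L) (N := N) (fun h => h2 (congr_arg (algebraMap B N) h))
    (i := ⟨i, hii⟩) (Subtype.ext (by simpa using hi))
    (θ := ⟨d • θ, hθd⟩) (θ' := ⟨d • θ', hθ'd⟩) (fun h => hθ (by
      have := congr_arg Subtype.val h
      simpa [Algebra.smul_def, hd0] using this))
  refine ⟨algebraMap k[X] L x / algebraMap k[X] L d, algebraMap k[X] L a / algebraMap k[X] L d, ?_⟩
  rintro ⟨y, hy⟩
  simp only [map_div₀, ← IsScalarTower.algebraMap_apply] at hy
  set D := algebraMap k[X] N d
  have hD : ((algebraMap k[X] N x - D * θ) ^ 2 + algebraMap k[X] N a ^ 2) *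
      ((algebraMap k[X] N x - D * θ') ^ 2 + algebraMap k[X] N a ^ 2) =
      (D ^ 2 * y) * (D ^ 2 * y) := by
    have : (D ^ 2 * y) * (D ^ 2 * y) = D ^ 4 * (y * y) := by ring
    rw [this, ← hy]
    field_simp
  have hint : IsIntegral k[X] (D ^ 2 * y) := by
    refine IsIntegral.of_pow two_pos ?_
    rw [pow_two, ← hD]
    simp only [Algebra.smul_def] at hθd hθ'd
    exact (((isIntegral_algebraMap.sub hθd).pow 2).add (isIntegral_algebraMap.pow 2)).mul
      (((isIntegral_algebraMap.sub hθ'd).pow 2).add (isIntegral_algebraMap.pow 2))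
  refine hxa ⟨⟨D ^ 2 * y, hint⟩, Subtype.ext ?_⟩
  simpa [Algebra.smul_def] using hD

/-- The exponent n is a power of the characteristic exponent that moves θ and θ' into the separable
closure of L. They stay distinct since Frobenius is injective, and a square root of a separable
element is separable because 2 ≠ 0. -/
theorem exists_not_isSquare_mul_add_sq (k : Type*) [Field k] [Algebra k[X] L]
    [IsFractionRing k[X] L] (h2 : (2 : N) ≠ 0) {i : N} (hi : i ^ 2 = -1)
    {θ θ' : N} (hθ : θ ≠ θ') :
    ∃ (n : ℕ) (x a : L), ¬ IsSquare (((algebraMap L N x - θ ^ n) ^ 2 + algebraMap L N a ^ 2) *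
      ((algebraMap L N x - θ' ^ n) ^ 2 + algebraMap L N a ^ 2)) := by
  obtain ⟨q, hq⟩ := ExpChar.exists L
  have := expChar_of_injective_algebraMap (algebraMap L N).injective q
  let S := separableClosure L N
  have := expChar_of_injective_algebraMap (algebraMap L S).injective q
  have hpow := (isPurelyInseparable_iff_pow_mem S (E := N) q).mp inferInstance
  obtain ⟨m, s, hs⟩ := hpow θ
  obtain ⟨m', s', hs'⟩ := hpow θ'
  have hne : s ^ q ^ m' ≠ s' ^ q ^ m := by
    intro h
    have := congr_arg (algebraMap S N) h
    rw [map_pow, map_pow, hs, hs', ← pow_mul, ← pow_mul, ← pow_add, ← pow_add, add_comm m'] at this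
    exact hθ ((iterateFrobenius N q (m + m')).injective (by simpa [iterateFrobenius_def] using this))
  have hiS : i ∈ S := mem_separableClosure_of_sq_mem h2 (by rw [hi]; exact neg_mem (one_mem _))
  obtain ⟨x, a, hxa⟩ := exists_not_isSquare_mul_add_sq_of_isSeparable L k (N := S)
    (fun h => h2 (congr_arg (algebraMap S N) h))
    (i := ⟨i, hiS⟩) (Subtype.ext hi) hne
  refine ⟨q ^ (m + m'), x, a, ?_⟩
  rintro ⟨y, hy⟩
  have e1 : θ ^ q ^ (m + m') = algebraMap S N (s ^ q ^ m') := by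
    rw [map_pow, hs, ← pow_mul, pow_add]
  have e2 : θ' ^ q ^ (m + m') = algebraMap S N (s' ^ q ^ m) := by
    rw [map_pow, hs', ← pow_mul, add_comm, pow_add]
  rw [e1, e2] at hy
  set z : S := ((algebraMap L S x - s ^ q ^ m') ^ 2 + algebraMap L S a ^ 2) *
    ((algebraMap L S x - s' ^ q ^ m) ^ 2 + algebraMap L S a ^ 2)
  have hz : (z : N) = y * y := hy
  have hyS : y ∈ S := mem_separableClosure_of_sq_mem h2 (by
    rw [pow_two, ← hz]; exact z.2)
  exact hxa ⟨⟨y, hyS⟩, Subtype.ext hz⟩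

end

/-! ### Reduction to function fields in one variable. -/

open scoped IntermediateField.algebraAdjoinAdjoin in
theorem exists_ratFunc_ringHom_finite_of_fg {k E : Type u} [Field k] [Field E] [Algebra k E]
    (hfg : (⊤ : IntermediateField k E).FG) (htr : 1 ≤ Algebra.trdeg k E) :
    ∃ (M : IntermediateField k E) (φ : RatFunc M →+* E), φ.Finite := by
  obtain ⟨s, hs⟩ := exists_isTranscendenceBasis k E
  have hne : Nonempty s := by
    rw [← Cardinal.one_le_iff_ne_zero.trans Cardinal.mk_ne_zero_iff, hs.cardinalMk_eq_trdeg]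
    exact htr
  obtain ⟨t, ht⟩ := hne
  -- All but one element of a transcendence basis are absorbed into the constants.
  let M := IntermediateField.adjoin k (s \ {t})
  have htM : Transcendental M t := by
    have h := hs.1.transcendental_adjoin (s := {⟨t, ht⟩}ᶜ) (i := ⟨t, ht⟩) (by simp)
    have himg : (Subtype.val : s → E) '' {⟨t, ht⟩}ᶜ = s \ {t} := by
      ext x; simp
    rw [himg] at h
    exact h.extendScalars M
  have halg : Algebra.IsAlgebraic M⟮t⟯ E := by
    have h := hs.isAlgebraic_field
    have hst : Set.range (Subtype.val : s → E) = s \ {t} ∪ {t} := by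
      rw [Subtype.range_coe, Set.sdiff_union_self, Set.union_eq_left.mpr (by simpa using ht)]
    rw [hst, ← IntermediateField.adjoin_adjoin_left] at h
    exact h
  have : Algebra.EssFiniteType k E := IntermediateField.fg_top_iff.mp hfg
  have : Algebra.EssFiniteType M E := .of_comp k M E
  have : Algebra.EssFiniteType M⟮t⟯ E := .of_comp M M⟮t⟯ E
  have hfin := Algebra.finite_of_essFiniteType_of_isAlgebraic (F := M⟮t⟯) (E := E)
  let e := (RatFunc.algEquivOfTranscendental t htM).toRingEquiv
  refine ⟨M, (algebraMap M⟮t⟯ E).comp e.toRingHom, ?_⟩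
  exact (RingHom.finite_algebraMap.mpr hfin).comp (.of_surjective _ e.surjective)

/-! ### Galois descent and the contradiction. -/

/-- If `f` becomes the square of `G` modulo the prime `p` over a Galois extension, then every
automorphism changes `G` at most by a sign. -/
theorem coeff_mul_coeff_mem_range_of_dvd_sq_sub {E K : Type*} [Field E] [Field K] [Algebra E K]
    [IsGalois E K] {p f : E[X]} (hp : Prime (p.map (algebraMap E K))) {G : K[X]}
    (hG : G.natDegree < p.natDegree)
    (hdvd : p.map (algebraMap E K) ∣ G ^ 2 - f.map (algebraMap E K)) (m n : ℕ) :
    G.coeff m * G.coeff n ∈ (algebraMap E K).range := by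
  rw [RingHom.mem_range, ← Set.mem_range, InfiniteGalois.mem_range_algebraMap_iff_fixed]
  intro σ
  have hfix : ∀ g : E[X], (g.map (algebraMap E K)).map (σ : K →+* K) = g.map (algebraMap E K) := by
    intro g
    rw [Polynomial.map_map]
    congr 1
    ext
    simp
  have h1 : p.map (algebraMap E K) ∣ (G.map (σ : K →+* K)) ^ 2 - f.map (algebraMap E K) := by
    have := Polynomial.map_dvd (σ : K →+* K) hdvd
    rwa [hfix, Polynomial.map_sub, hfix, Polynomial.map_pow] at this
  have h2 : p.map (algebraMap E K) ∣
      (G.map (σ : K →+* K) - G) * (G.map (σ : K →+* K) + G) := by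
    convert dvd_sub h1 hdvd using 1
    ring
  have hdeg : (G.map (σ : K →+* K)).natDegree < (p.map (algebraMap E K)).natDegree := by
    rwa [natDegree_map, natDegree_map]
  rw [← natDegree_map (algebraMap E K)] at hG
  rcases hp.dvd_or_dvd h2 with h | h
  · have h0 := eq_zero_of_dvd_of_natDegree_lt h
      ((natDegree_sub_le _ _).trans_lt (max_lt hdeg hG))
    have hc : ∀ j, σ (G.coeff j) = G.coeff j := fun j => by
      have := congr_arg (coeff · j) h0
      simpa [sub_eq_zero] using this
    rw [map_mul, hc, hc]
  · have h0 := eq_zero_of_dvd_of_natDegree_lt h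
      ((natDegree_add_le _ _).trans_lt (max_lt hdeg hG))
    have hc : ∀ j, σ (G.coeff j) = -G.coeff j := fun j => by
      have := congr_arg (coeff · j) h0
      simpa [add_eq_zero_iff_eq_neg] using this
    rw [map_mul, hc, hc, neg_mul_neg]

theorem exists_primitive_separableClosure {K F : Type*} [Field K] [Field F] [Algebra K F]
    [FiniteDimensional K F] (hpi : ¬ IsPurelyInseparable K F) :
    ∃ pb : PowerBasis K (separableClosure K F), 1 < pb.dim := by
  refine ⟨Field.powerBasisOfFiniteOfSeparable K _, ?_⟩
  rw [← PowerBasis.finrank]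
  by_contra! h
  refine hpi (separableClosure.eq_bot_iff.mp (IntermediateField.finrank_eq_one_iff.mp ?_))
  exact le_antisymm h Module.finrank_pos

theorem IsPythagorean.separableClosure {K F : Type*} [Field K] [Field F] [Algebra K F]
    (hF : IsPythagorean F) (h2 : (2 : F) ≠ 0) : IsPythagorean (separableClosure K F) := by
  intro z hz
  have hzF : IsSumSq (z : F) := by
    induction hz with
    | zero => exact .zero
    | sq_add a _ ih => exact ih.sq_add (a : F)
  obtain ⟨y, hy⟩ := hF z hzF
  have hyS : y ∈ _root_.separableClosure K F := mem_separableClosure_of_sq_mem h2 (by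
    rw [pow_two, ← hy]; exact z.2)
  exact ⟨⟨y, hyS⟩, Subtype.ext hy⟩

/-- Every Galois extension of a function field in one variable of characteristic different from
two is hereditarily non-pythagorean. -/
theorem isHereditarilyNonPythagorean_of_isGalois {k E Ω : Type*} [Field k] [Field E] [Field Ω]
    [Algebra E Ω] [IsAlgClosed Ω] [Algebra.IsAlgebraic E Ω] (h2 : (2 : E) ≠ 0)
    (φ : RatFunc k →+* E) (hφ : φ.Finite) (K : IntermediateField E Ω) [IsGalois E K] :
    IsHereditarilyNonPythagorean K := by
  intro F _ _ _ _ hpi hpyth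
  have h2K : (2 : K) ≠ 0 := fun h =>
    h2 ((algebraMap E K).injective (by rw [map_zero, ← h]; exact map_ofNat _ 2))
  have h2F : (2 : F) ≠ 0 := fun h =>
    h2K ((algebraMap K F).injective (by rw [map_zero, ← h]; exact map_ofNat _ 2))
  have h2Ω : (2 : Ω) ≠ 0 := fun h => h2K (Subtype.ext h)
  obtain ⟨pb, hpb⟩ := exists_primitive_separableClosure hpi
  set p := minpoly K pb.gen with hp
  have hpd : p.natDegree = pb.dim := pb.natDegree_minpoly
  obtain ⟨θ₁, θ₂, hθ⟩ : ∃ θ₁ θ₂ : p.rootSet Ω, θ₁ ≠ θ₂ := by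
    refine Fintype.exists_pair_of_one_lt_card ?_
    rw [card_rootSet_eq_natDegree (Algebra.IsSeparable.isSeparable K pb.gen)
      (IsAlgClosed.splits _)]
    change 1 < p.natDegree
    omega
  obtain ⟨i, hi⟩ := IsAlgClosed.exists_pow_nat_eq (-1 : Ω) two_pos
  -- The coefficients of p are included so that N contains the field E₀ to which products of
  -- coefficients of G descend.
  let s : Set Ω := K.val '' p.coeffs ∪ {↑θ₁, ↑θ₂, i}
  have hs : s.Finite := (p.coeffs.finite_toSet.image _).union (by simp)
  let N := IntermediateField.adjoin E s
  have : Finite s := hs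
  have : FiniteDimensional E N := IntermediateField.finiteDimensional_adjoin fun x _ =>
    Algebra.IsIntegral.isIntegral x
  have hsN : s ⊆ N := IntermediateField.subset_adjoin E s
  have h1N : (θ₁ : Ω) ∈ N := hsN (by simp [s])
  have h2N : (θ₂ : Ω) ∈ N := hsN (by simp [s])
  have hiN : i ∈ N := hsN (by simp [s])
  let : Algebra (RatFunc k) E := φ.toAlgebra
  let : Algebra (RatFunc k) N := ((algebraMap E N).comp φ).toAlgebra
  have : IsScalarTower (RatFunc k) E N := .of_algebraMap_eq' rfl
  have : FiniteDimensional (RatFunc k) E := hφ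
  have : FiniteDimensional (RatFunc k) N := Module.Finite.trans E N
  obtain ⟨n, x, a, hxa⟩ := exists_not_isSquare_mul_add_sq (RatFunc k) k (N := N)
    (fun h => h2Ω (congr_arg (algebraMap N Ω) h)) (i := ⟨i, hiN⟩) (Subtype.ext hi)
    (θ := ⟨θ₁, h1N⟩) (θ' := ⟨θ₂, h2N⟩) (fun h => hθ (Subtype.ext (congr_arg (algebraMap N Ω) h)))
  let E₀ := IntermediateField.adjoin E (p.coeffs : Set K)
  have hE₀N : ∀ c ∈ E₀, K.val c ∈ N := by
    have : E₀ ≤ N.comap K.val := IntermediateField.adjoin_le_iff.mpr fun c hc =>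
      hsN (Or.inl ⟨c, hc, rfl⟩)
    exact this
  obtain ⟨p₀, hp₀⟩ : ∃ p₀ : E₀[X], p₀.map (algebraMap E₀ K) = p := by
    rw [← mem_lifts, lifts_iff_coeff_lifts]
    intro j
    rcases eq_or_ne (p.coeff j) 0 with h | h
    · exact ⟨0, by rw [h, map_zero]⟩
    · exact ⟨⟨_, IntermediateField.subset_adjoin E _ (coeff_mem_coeffs h)⟩, rfl⟩
  let f₀ : E₀[X] := (C (algebraMap E E₀ (φ x)) - X ^ n) ^ 2 + C (algebraMap E E₀ (φ a)) ^ 2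
  obtain ⟨y, hy⟩ := hpyth.separableClosure (K := K) h2F
    ((algebraMap K _ (algebraMap E K (φ x)) - pb.gen ^ n) ^ 2 +
      algebraMap K _ (algebraMap E K (φ a)) ^ 2) (by
        rw [pow_two (_ - _), pow_two (algebraMap K _ _)]
        exact (IsSumSq.mul_self _).add (IsSumSq.mul_self _))
  obtain ⟨G, hGd, rfl⟩ := pb.exists_eq_aeval y
  have hf₀ : f₀.map (algebraMap E₀ K) = (C (algebraMap E K (φ x)) - X ^ n) ^ 2 +
      C (algebraMap E K (φ a)) ^ 2 := by
    simp [f₀, ← IsScalarTower.algebraMap_apply]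
  have hdvd : p ∣ G ^ 2 - f₀.map (algebraMap E₀ K) := by
    refine minpoly.dvd _ _ ?_
    rw [hf₀]
    simp only [map_sub, map_pow, map_add, aeval_X, aeval_C]
    rw [hy, pow_two, sub_self]
  have hGmem : ∀ m l, K.val (G.coeff m * G.coeff l) ∈ N := by
    intro m l
    obtain ⟨c, hc⟩ := coeff_mul_coeff_mem_range_of_dvd_sq_sub (p := p₀) (f := f₀) (G := G)
      (by rw [hp₀]; exact minpoly.prime (Algebra.IsIntegral.isIntegral _))
      (by rw [← natDegree_map (algebraMap E₀ K), hp₀, hpd]; exact hGd)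
      (by rwa [hp₀]) m l
    rw [← hc]
    exact hE₀N _ c.2
  have hroot : ∀ θ : p.rootSet Ω, (algebraMap E Ω (φ x) - (θ : Ω) ^ n) ^ 2 +
      algebraMap E Ω (φ a) ^ 2 = aeval (θ : Ω) G ^ 2 := by
    intro θ
    obtain ⟨g, hg⟩ := hdvd
    have h := congr_arg (aeval (θ : Ω)) hg
    rw [hf₀, map_mul, aeval_eq_zero_of_mem_rootSet θ.2, zero_mul] at h
    simp only [map_sub, map_pow, map_add, aeval_X, aeval_C,
      ← IsScalarTower.algebraMap_apply] at h
    exact (sub_eq_zero.mp h).symm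
  -- G itself need not have coefficients in N, but G(θ₁)G(θ₂) involves only products of two of them.
  have hmem : aeval (θ₁ : Ω) G * aeval (θ₂ : Ω) G ∈ N := by
    rw [aeval_eq_sum_range, aeval_eq_sum_range, Finset.sum_mul_sum]
    refine sum_mem fun m _ => sum_mem fun l _ => ?_
    have : G.coeff m • (θ₁ : Ω) ^ m * G.coeff l • (θ₂ : Ω) ^ l =
        K.val (G.coeff m * G.coeff l) * ((θ₁ : Ω) ^ m * (θ₂ : Ω) ^ l) := by
      rw [Algebra.smul_def, Algebra.smul_def, map_mul]
      change K.val (G.coeff m) * _ * (K.val (G.coeff l) * _) = _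
      ring
    rw [this]
    exact mul_mem (hGmem m l) (mul_mem (pow_mem h1N m) (pow_mem h2N l))
  refine hxa ⟨⟨_, hmem⟩, Subtype.ext ?_⟩
  change ((algebraMap E Ω (φ x) - (θ₁ : Ω) ^ n) ^ 2 + algebraMap E Ω (φ a) ^ 2) *
    ((algebraMap E Ω (φ x) - (θ₂ : Ω) ^ n) ^ 2 + algebraMap E Ω (φ a) ^ 2) = _ * _
  rw [hroot, hroot]
  ring

/-! ### The two closures are Galois over E. -/

section

variable {E : Type u} [Field E] {Ω : Type v} [Field Ω] [Algebra E Ω]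

theorem IsPythagoreanTower.isQuadraticTower {L : IntermediateField E Ω}
    (h : IsPythagoreanTower E Ω L) : IsQuadraticTower E Ω L := by
  induction h with
  | base => exact .base
  | step K a b c _ ha hb hc ih =>
    exact .step K _ c ih (add_mem (pow_mem ha 2) (pow_mem hb 2)) hc

theorem IsQuadraticTower.le_separableClosure (h2 : (2 : Ω) ≠ 0) {L : IntermediateField E Ω}
    (h : IsQuadraticTower E Ω L) : L ≤ separableClosure E Ω := by
  induction h with
  | base => exact bot_le
  | step K a c _ ha hc ih =>
    refine sup_le ih ((IntermediateField.adjoin_simple_le_iff).mpr ?_)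
    exact mem_separableClosure_of_sq_mem h2 (hc ▸ ih ha)

theorem IsQuadraticTower.map {L : IntermediateField E Ω} (h : IsQuadraticTower E Ω L)
    (σ : Ω →ₐ[E] Ω) : IsQuadraticTower E Ω (L.map σ) := by
  induction h with
  | base => rw [IntermediateField.map_bot]; exact .base
  | step K a c _ ha hc ih =>
    rw [IntermediateField.map_sup, IntermediateField.adjoin_map, Set.image_singleton]
    exact .step _ (σ a) _ ih ⟨a, ha, rfl⟩ (by rw [← map_pow, hc])

theorem IsPythagoreanTower.map {L : IntermediateField E Ω} (h : IsPythagoreanTower E Ω L)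
    (σ : Ω →ₐ[E] Ω) : IsPythagoreanTower E Ω (L.map σ) := by
  induction h with
  | base => rw [IntermediateField.map_bot]; exact .base
  | step K a b c _ ha hb hc ih =>
    rw [IntermediateField.map_sup, IntermediateField.adjoin_map, Set.image_singleton]
    exact .step _ (σ a) (σ b) _ ih ⟨a, ha, rfl⟩ ⟨b, hb, rfl⟩
      (by rw [← map_pow, hc, map_add, map_pow, map_pow])

/-- Stability of the family under E-embeddings gives normality of its supremum, even if no single
member is normal. -/
theorem isGalois_sSup [Normal E Ω] {T : Set (IntermediateField E Ω)}
    (hsep : ∀ L ∈ T, L ≤ separableClosure E Ω)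
    (hmap : ∀ L ∈ T, ∀ σ : Ω →ₐ[E] Ω, L.map σ ∈ T) : IsGalois E ↥(sSup T) := by
  have h1 : Algebra.IsSeparable E ↥(sSup T) := (le_separableClosure_iff _ _ _).mp (sSup_le hsep)
  have h2 : Normal E ↥(sSup T) := by
    rw [IntermediateField.normal_iff_forall_map_le]
    intro σ
    rw [IntermediateField.map_le_iff_le_comap]
    exact sSup_le fun L hL => IntermediateField.map_le_iff_le_comap.mp (le_sSup (hmap L hL σ))
  exact ⟨⟩

theorem isGalois_quadraticClosure [Normal E Ω] (h2 : (2 : Ω) ≠ 0) :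
    IsGalois E (quadraticClosure E Ω) :=
  isGalois_sSup (fun _ hL => IsQuadraticTower.le_separableClosure h2 hL) fun _ hL σ => hL.map σ

theorem isGalois_pythagoreanClosure [Normal E Ω] (h2 : (2 : Ω) ≠ 0) :
    IsGalois E (pythagoreanClosure E Ω) :=
  isGalois_sSup
    (fun _ hL => IsQuadraticTower.le_separableClosure h2 (IsPythagoreanTower.isQuadraticTower hL))
    fun _ hL σ => hL.map σ

end

theorem mainTheorem4 {E : Type u} [Field E] (hchar : ringChar E ≠ 2)
    (k : Subfield E) (hfg : (⊤ : IntermediateField k E).FG) (htr : 1 ≤ Algebra.trdeg k E)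
    (Ω : Type v) [Field Ω] [Algebra E Ω] [IsAlgClosure E Ω] :
    IsHereditarilyNonPythagorean (pythagoreanClosure E Ω) ∧
      IsHereditarilyNonPythagorean (quadraticClosure E Ω) := by
  have h2 : (2 : E) ≠ 0 := Ring.two_ne_zero hchar
  have h2Ω : (2 : Ω) ≠ 0 := fun h =>
    h2 ((algebraMap E Ω).injective (by rw [map_zero, ← h]; exact map_ofNat _ 2))
  have : IsAlgClosed Ω := IsAlgClosure.isAlgClosed E
  have : Algebra.IsAlgebraic E Ω := IsAlgClosure.isAlgebraic
  have : Normal E Ω := IsAlgClosure.normal E Ω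
  obtain ⟨M, φ, hφ⟩ := exists_ratFunc_ringHom_finite_of_fg hfg htr
  have := isGalois_pythagoreanClosure (E := E) h2Ω
  have := isGalois_quadraticClosure (E := E) h2Ω
  exact ⟨isHereditarilyNonPythagorean_of_isGalois h2 φ hφ _,
    isHereditarilyNonPythagorean_of_isGalois h2 φ hφ _⟩
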